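/- A hypergraph $\mathcal H$ consists of a finite vertex set $V(\mathcal H)$ and a set $E(\mathcal H)$ of subsets of $V(\mathcal H)$, called edges. It is $r$-uniform if every edge has exactly $r$ vertices, linear if any two distinct edges share at most one vertex, and $r$-partite, with vertex parts $V_1,\dots,V_r$, if $V(\mathcal H)$ is the disjoint union of $V_1,\dots,V_r$ and no edge contains two distinct vertices of the same part. A rainbow cycle of length $k\ge 2$ in such an $r$-partite hypergraph is a sequence $v_1,A_1,v_2,A_2,\dots,v_k,A_k,v_1$ in which $v_1,\dots,v_k$ are distinct vertices lying in $k$ different parts, $A_1,\dots,A_k$ are distinct edges, $v_i,v_{i+1}\in A_i$ for $1\le i\le k-1$, and $v_k,v_1\in A_k$. **Theorem 1.5.** For every integer $r\ge 3$ there is a function $\varepsilon_r:\mathbb N\to\mathbb R$ with $\varepsilon_r(n)\to 0$ as $n\to\infty$ such that for all sufficiently large $n$ there exists an $r$-uniform, $r$-partite, linear hypergraph $\mathcal H$ on exactly $n$ vertices, with $$|E(\mathcal H)|>n^{2-\varepsilon_r(n)},$$ which contains no rainbow cycle of length $3$ or $4$. -/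

import Mathlib

open Filter Topology

namespace Hypergraph

/-- `H` is `r`-uniform: every edge has exactly `r` vertices. -/
def IsRUniform {α : Type*} (H : Hypergraph α) (r : ℕ) : Prop :=
  ∀ A ∈ H.edgeSet, A.encard = r

/-- `H` is linear: two distinct edges share at most one vertex. -/
def IsLinearHypergraph {α : Type*} (H : Hypergraph α) : Prop :=
  ∀ A ∈ H.edgeSet, ∀ B ∈ H.edgeSet, A ≠ B → (A ∩ B).encard ≤ 1

/-- The colouring `c` of the vertices in `r` colours makes `H` an `r`-partite hypergraph: no edge
contains two distinct vertices of the same colour. The vertex parts are the colour classes of `c`. -/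
def IsPartiteColoring {α : Type*} (H : Hypergraph α) {r : ℕ} (c : α → Fin r) : Prop :=
  ∀ A ∈ H.edgeSet, ∀ x ∈ A, ∀ y ∈ A, c x = c y → x = y

/-- `v 0, A 0, v 1, A 1, …, v (k-1), A (k-1), v 0` is a (Berge) cycle of length `k` in `H`.
The permutation `finRotate k` sends `i` to `i + 1` and `k - 1` to `0`. -/
structure IsBergeCycle {α : Type*} (H : Hypergraph α) (k : ℕ)
    (v : Fin k → α) (A : Fin k → Set α) : Prop where
  two_le : 2 ≤ k
  vertex_mem : ∀ i, v i ∈ H.vertexSet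
  edge_mem : ∀ i, A i ∈ H.edgeSet
  vertex_injective : Function.Injective v
  edge_injective : Function.Injective A
  mem_left : ∀ i, v i ∈ A i
  mem_right : ∀ i, v (finRotate k i) ∈ A i

/-- `H`, with the vertex parts given by the colouring `c`, contains a rainbow cycle of length `k`:
a Berge cycle whose `k` vertices lie in `k` different parts. -/
def HasRainbowCycle {α : Type*} (H : Hypergraph α) {r : ℕ} (c : α → Fin r) (k : ℕ) : Prop :=
  ∃ (v : Fin k → α) (A : Fin k → Set α), H.IsBergeCycle k v A ∧ Function.Injective (c ∘ v)

end Hypergraph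

/-! An edge is a pair `(x, y)` of `d`-tuples of integer polynomials in `r` variables with
coefficients below `M`, of degree at most `L` in each variable for `x` and less than `L` for `y`.
Its vertex of colour `i` is `x + X i * y`. Around a rainbow cycle the `x` cancel, leaving `∑ X (i
(t+1)) * (y (t+1) - y t) = 0`. At a point whose coordinates increase along the cycle, this makes the
last value vector of `y` a convex combination of the others. If all value vectors there have equal
norm, strict convexity makes them equal. So `y`, and then `x`, is constant, and cycles of every
length are excluded. Pigeonhole gives equal norms on a fixed grid at a cost of `M ^ (2 * (r * L) ^
r)` up to a constant, independent of `d` in the exponent. There are about `M ^ (d * (L + 1) ^ r)`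
vertices and `M ^ (d * (L + 1) ^ r + d * L ^ r)` edges before this loss; large `L`, then large `d`,
brings the exponent near 2. -/

namespace Hypergraph

/-! ### From incidence systems to hypergraphs -/

/-- An incidence system `p : E → Fin r → α`, in which the `i`-th vertex has colour `i`, gives an
`r`-uniform `r`-partite hypergraph. If every closed rainbow chain of members of `E` is constant,
this hypergraph is linear and has no rainbow cycle. -/
theorem exists_of_incidence {α E : Type*} {r : ℕ} (hr : 2 ≤ r) (p : E → Fin r → α)
    (c : α → Fin r) (hc : ∀ e i, c (p e i) = i)
    (h : ∀ k, 2 ≤ k → ∀ (i : Fin k → Fin r) (e : Fin k → E), Function.Injective i →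
      (∀ t, p (e t) (i (finRotate k t)) = p (e (finRotate k t)) (i (finRotate k t))) →
      ∀ s t, e s = e t) :
    ∃ H : Hypergraph α, H.vertexSet = Set.univ ∧ H.IsRUniform r ∧ H.IsPartiteColoring c ∧
      H.IsLinearHypergraph ∧ H.edgeSet.ncard = Nat.card E ∧ ∀ k, ¬ H.HasRainbowCycle c k := by
  let H : Hypergraph α :=
    { vertexSet := Set.univ
      edgeSet := Set.range fun e => Set.range (p e)
      subset_vertexSet_of_mem_edgeSet' := fun _ _ => Set.subset_univ _ }
  have hinj : ∀ e, Function.Injective (p e) := fun e i j hij => by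
    rw [← hc e i, hij, hc]
  have hmem : ∀ {e x}, x ∈ Set.range (p e) → p e (c x) = x := by
    rintro e _ ⟨i, rfl⟩
    rw [hc]
  have hpart : H.IsPartiteColoring c := by
    rintro _ ⟨e, rfl⟩ x hx y hy hxy
    rw [← hmem hx, ← hmem hy, hxy]
  have hcyc : ∀ k, ¬ H.HasRainbowCycle c k := by
    rintro k ⟨v, A, hC, hv⟩
    choose e he using hC.edge_mem
    have hst := h k hC.two_le (c ∘ v) e hv fun t => by
      have h1 := hC.mem_right t
      have h2 := hC.mem_left (finRotate k t)
      rw [← he] at h1 h2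
      exact (hmem h1).trans (hmem h2).symm
    have h2 := hC.two_le
    have h01 : A ⟨0, by omega⟩ = A ⟨1, by omega⟩ := by rw [← he, ← he, hst]
    simpa using hC.edge_injective h01
  refine ⟨H, rfl, ?_, hpart, ?_, ?_, hcyc⟩
  · rintro _ ⟨e, rfl⟩
    change (Set.range (p e)).encard = r
    rw [← Set.image_univ, (hinj e).encard_image]
    simp
  · intro A hA B hB hAB
    rw [Set.encard_le_one_iff]
    intro x y hx hy
    by_contra hxy
    -- Two vertices shared by distinct edges form a rainbow 2-cycle.
    refine hcyc 2 ⟨![x, y], ![A, B], ⟨le_rfl, fun _ => Set.mem_univ _, ?_, ?_, ?_, ?_, ?_⟩, ?_⟩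
    · intro i; fin_cases i <;> simpa
    · intro i j hij; fin_cases i <;> fin_cases j <;> simp_all
    · intro i j hij; fin_cases i <;> fin_cases j <;> simp_all
    · intro i; fin_cases i
      · exact hx.1
      · exact hy.2
    · intro i; fin_cases i
      · exact hy.1
      · exact hx.2
    · have hne : c x ≠ c y := fun hxy' => hxy (hpart A hA x hx.1 y hy.1 hxy')
      intro i j hij; fin_cases i <;> fin_cases j <;> simp_all
  · have hE : Function.Injective fun e => Set.range (p e) := by
      intro e e' hee
      have key : ∀ i, p e i = p e' i := fun i => by
        have : p e i ∈ Set.range (p e') := by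
          rw [← show Set.range (p e) = Set.range (p e') from hee]; exact ⟨i, rfl⟩
        have := hmem this
        rw [hc] at this
        exact this.symm
      have h0 : finRotate 2 0 = 1 := by decide
      have h1 : finRotate 2 1 = 0 := by decide
      refine h 2 le_rfl (Fin.castLE hr) ![e, e'] (Fin.castLE_injective hr) ?_ 0 1
      rw [Fin.forall_fin_two, h0, h1]
      exact ⟨key _, (key _).symm⟩
    change (Set.range fun e => Set.range (p e)).ncard = _
    rw [← Set.image_univ, Set.ncard_image_of_injective _ hE, Set.ncard_univ]

end Hypergraph

/-! ### Strict convexity -/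

/-- Vectors of equal norm satisfying the relation of a closed chain with increasing slopes are all
equal: the last one is a convex combination of the others. -/
theorem eq_of_sum_mul_sub_finRotate_eq_zero {ι : Type*} [Fintype ι] {k : ℕ} (a : Fin k → ℤ)
    (ha : StrictMono a) (u : Fin k → ι → ℤ) (R : ℤ) (hu : ∀ t, ∑ b, u t b ^ 2 = R)
    (h : ∀ b, ∑ t, a (finRotate k t) * (u (finRotate k t) b - u t b) = 0) (s t : Fin k) :
    u s = u t := by
  obtain _ | k := k
  · exact s.elim0
  suffices H : ∀ t, u t = u (Fin.last k) from (H s).trans (H t).symm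
  set w := u (Fin.last k) with hw
  -- Squared distance to the last vector: affine in `u t` because the norms agree, so it inherits
  -- the linear relation.
  let g : Fin (k + 1) → ℤ := fun t => ∑ b, (u t b - w b) ^ 2
  have hg0 : ∀ t, 0 ≤ g t := fun t => Finset.sum_nonneg fun b _ => sq_nonneg _
  have hg : ∀ t, g t = 2 * R - 2 * ∑ b, u t b * w b := fun t => by
    have : g t = ∑ b, u t b ^ 2 + ∑ b, w b ^ 2 - 2 * ∑ b, u t b * w b := by
      simp only [g, Finset.mul_sum, ← Finset.sum_add_distrib, ← Finset.sum_sub_distrib]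
      exact Finset.sum_congr rfl fun b _ => by ring
    rw [this, hu, hw, hu]; ring
  have hsum : ∑ t, a (finRotate _ t) * (g (finRotate _ t) - g t) = 0 := by
    have : ∀ t, a (finRotate _ t) * (g (finRotate _ t) - g t) =
        ∑ b, (-2 * w b) * (a (finRotate _ t) * (u (finRotate _ t) b - u t b)) := fun t => by
      rw [hg, hg]
      have : 2 * R - 2 * ∑ b, u (finRotate _ t) b * w b - (2 * R - 2 * ∑ b, u t b * w b) =
          ∑ b, (-2 * w b) * (u (finRotate _ t) b - u t b) := by
        rw [sub_sub_sub_cancel_left, ← mul_sub, ← Finset.sum_sub_distrib, Finset.mul_sum]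
        exact Finset.sum_congr rfl fun b _ => by ring
      rw [this, Finset.mul_sum]
      exact Finset.sum_congr rfl fun b _ => by ring
    simp_rw [this]
    rw [Finset.sum_comm]
    simp_rw [← Finset.mul_sum, h, mul_zero, Finset.sum_const_zero]
  -- Abel summation. The only negative coefficient, at the last index, multiplies `g = 0`.
  have hsum' : ∑ t, (a (finRotate _ t) - a t) * g t = 0 := by
    have e1 : ∑ t, a (finRotate _ t) * g (finRotate _ t) = ∑ t, a t * g t :=
      Equiv.sum_comp (finRotate (k + 1)) fun t => a t * g t
    simp only [mul_sub, sub_mul, Finset.sum_sub_distrib] at hsum ⊢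
    linarith
  have hlast : g (Fin.last k) = 0 := by simp [g, hw]
  have hlt : ∀ t, t ≠ Fin.last k → 0 < a (finRotate _ t) - a t := fun t ht => by
    rw [sub_pos]
    apply ha
    rw [Fin.lt_def, coe_finRotate_of_ne_last ht]
    omega
  have hnn : ∀ t ∈ Finset.univ, 0 ≤ (a (finRotate _ t) - a t) * g t := fun t _ => by
    by_cases ht : t = Fin.last k
    · rw [ht, hlast, mul_zero]
    · exact mul_nonneg (hlt t ht).le (hg0 t)
  intro t
  by_cases ht : t = Fin.last k
  · rw [ht]
  have := (Finset.sum_eq_zero_iff_of_nonneg hnn).1 hsum' t (Finset.mem_univ _)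
  have hgt : g t = 0 := (mul_eq_zero.1 this).resolve_left (hlt t ht).ne'
  ext b
  have := (Finset.sum_eq_zero_iff_of_nonneg fun b _ => sq_nonneg _).1 hgt b (Finset.mem_univ _)
  exact sub_eq_zero.1 (pow_eq_zero_iff two_ne_zero |>.1 this)

/-! ### Polynomials with bounded degrees and coefficients -/

namespace MvPolynomial

/-- The polynomial in `r` variables, of degree less than `L` in each of them, with given
coefficients in `{0, …, K - 1}`. -/
noncomputable def ofBox {r L K : ℕ} (f : (Fin r → Fin L) → Fin K) : MvPolynomial (Fin r) ℤ :=
  ∑ m, monomial (Finsupp.equivFunOnFinite.symm fun i => (m i : ℕ)) ((f m : ℕ) : ℤ)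

theorem coeff_ofBox {r L K : ℕ} (f : (Fin r → Fin L) → Fin K) (m : Fin r → Fin L) :
    coeff (Finsupp.equivFunOnFinite.symm fun i => (m i : ℕ)) (ofBox f) = ((f m : ℕ) : ℤ) := by
  classical
  rw [ofBox, coeff_sum, Finset.sum_eq_single m]
  · simp
  · intro m' _ hne
    rw [coeff_monomial, if_neg]
    intro heq
    apply hne
    ext i
    exact congrFun (Finsupp.equivFunOnFinite.symm.injective heq) i
  · simp

theorem coeff_ofBox_eq_zero {r L K : ℕ} (f : (Fin r → Fin L) → Fin K) (m : Fin r →₀ ℕ) (i : Fin r)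
    (hi : L ≤ m i) : coeff m (ofBox f) = 0 := by
  classical
  rw [ofBox, coeff_sum]
  refine Finset.sum_eq_zero fun m' _ => ?_
  rw [coeff_monomial, if_neg]
  rintro rfl
  exact absurd (m' i).2 (not_lt.2 hi)

theorem coeff_ofBox_mem {r L K : ℕ} (hK : 0 < K) (f : (Fin r → Fin L) → Fin K)
    (m : Fin r →₀ ℕ) : 0 ≤ coeff m (ofBox f) ∧ coeff m (ofBox f) < K := by
  by_cases h : ∀ i, m i < L
  · have := coeff_ofBox f fun i => ⟨m i, h i⟩
    have hm : (Finsupp.equivFunOnFinite.symm fun i => m i) = m := by ext; simp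
    simp only [hm] at this
    rw [this]
    have := (f fun i => ⟨m i, h i⟩).2
    omega
  · push Not at h
    obtain ⟨i, hi⟩ := h
    rw [coeff_ofBox_eq_zero f m i hi]
    omega

theorem ofBox_injective {r L K : ℕ} : Function.Injective (ofBox (r := r) (L := L) (K := K)) := by
  intro f g hfg
  ext m
  have := coeff_ofBox f m
  rw [hfg, coeff_ofBox] at this
  exact_mod_cast this.symm

theorem exists_ofBox_eq {r L K : ℕ} (p : MvPolynomial (Fin r) ℤ)
    (hp : ∀ m, 0 ≤ coeff m p ∧ coeff m p < K) (hp' : ∀ m i, L ≤ m i → coeff m p = 0) :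
    ∃ f : (Fin r → Fin L) → Fin K, ofBox f = p := by
  refine ⟨fun m => ⟨(coeff (Finsupp.equivFunOnFinite.symm fun i => (m i : ℕ)) p).toNat, ?_⟩, ?_⟩
  · have := hp (Finsupp.equivFunOnFinite.symm fun i => (m i : ℕ))
    omega
  · ext m
    by_cases h : ∀ i, m i < L
    · have hm : (Finsupp.equivFunOnFinite.symm fun i => m i) = m := by ext; simp
      have := coeff_ofBox (K := K) (fun m => ⟨(coeff (Finsupp.equivFunOnFinite.symm fun i =>
        (m i : ℕ)) p).toNat, by
          have := hp (Finsupp.equivFunOnFinite.symm fun i => (m i : ℕ)); omega⟩)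
        (fun i => ⟨m i, h i⟩ : Fin r → Fin L)
      simp only [hm] at this
      rw [this, Int.toNat_of_nonneg (hp m).1]
    · push Not at h
      obtain ⟨i, hi⟩ := h
      rw [coeff_ofBox_eq_zero _ m i hi, hp' m i hi]

theorem exists_ofBox_eq_add_X_mul {r L M : ℕ} (hM : 0 < M) (x : (Fin r → Fin (L + 1)) → Fin M)
    (y : (Fin r → Fin L) → Fin M) (i : Fin r) :
    ∃ f : (Fin r → Fin (L + 1)) → Fin (2 * M), ofBox f = ofBox x + X i * ofBox y := by
  refine exists_ofBox_eq _ (fun m => ?_) fun m j hj => ?_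
  · rw [coeff_add, coeff_X_mul']
    have h1 := coeff_ofBox_mem hM x m
    have h2 := coeff_ofBox_mem hM y (m - Finsupp.single i 1)
    split_ifs <;> push_cast <;> omega
  · rw [coeff_add, coeff_X_mul', coeff_ofBox_eq_zero x m j hj, zero_add]
    split_ifs
    · refine coeff_ofBox_eq_zero y _ j ?_
      rw [Finsupp.tsub_apply, Finsupp.single_apply]
      split_ifs <;> omega
    · rfl

/-- A common bound for the values of the monomials of degree less than `L` in each variable at
points with coordinates in `{0, …, N - 1}`, summed over the monomials. -/
theorem abs_eval_ofBox_le (r L N : ℕ) : ∃ W : ℕ, ∀ (M : ℕ) (f : (Fin r → Fin L) → Fin M)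
    (τ : Fin r → Fin N), |eval (fun i => ((τ i : ℕ) : ℤ)) (ofBox f)| ≤ (M * W : ℕ) := by
  refine ⟨∑ m : Fin r → Fin L, ∏ i, N ^ (m i : ℕ), fun M f τ => ?_⟩
  rw [ofBox, map_sum]
  refine (Finset.abs_sum_le_sum_abs _ _).trans ?_
  rw [Finset.mul_sum]
  push_cast
  refine Finset.sum_le_sum fun m _ => ?_
  rw [eval_monomial, abs_mul, Finsupp.prod_fintype _ _ (fun i => pow_zero _), Finset.abs_prod]
  refine mul_le_mul ?_ ?_ (Finset.prod_nonneg fun i _ => abs_nonneg _) (by positivity)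
  · rw [Nat.abs_cast]
    exact_mod_cast (f m).2.le
  · refine Finset.prod_le_prod (fun i _ => abs_nonneg _) fun i _ => ?_
    rw [abs_pow, Nat.abs_cast]
    exact pow_le_pow_left₀ (by positivity) (by exact_mod_cast (τ i).2.le) _

/-- Degrees below `L` make a product grid of side `L` determine the polynomial. -/
theorem ofBox_eq_of_eval_eq {r L K : ℕ} (hL : 0 < L) (f g : (Fin r → Fin L) → Fin K)
    (S : Fin r → Finset ℤ) (hS : ∀ i, L ≤ (S i).card)
    (h : ∀ x : Fin r → ℤ, (∀ i, x i ∈ S i) → eval x (ofBox f) = eval x (ofBox g)) :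
    f = g := by
  apply ofBox_injective
  rw [← sub_eq_zero]
  refine eq_zero_of_eval_zero_at_prod_finset _ S (fun i => ?_) fun x hx => ?_
  · refine lt_of_lt_of_le ?_ (hS i)
    rw [degreeOf_lt_iff hL]
    intro m hm
    by_contra hmi
    rw [mem_support_iff, coeff_sub, coeff_ofBox_eq_zero f m i (not_lt.1 hmi),
      coeff_ofBox_eq_zero g m i (not_lt.1 hmi)] at hm
    simp at hm
  · rw [map_sub, h x hx, sub_self]

end MvPolynomial

theorem eq_of_forall_eq_finRotate {β : Type*} {k : ℕ} (x : Fin k → β)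
    (h : ∀ t, x t = x (finRotate k t)) (s t : Fin k) : x s = x t := by
  obtain _ | k := k
  · exact s.elim0
  suffices H : ∀ t, x t = x 0 from (H s).trans (H t).symm
  intro t
  induction t using Fin.induction with
  | zero => rfl
  | succ t ih =>
    rw [← ih, h t.castSucc]
    congr 1
    ext
    rw [coe_finRotate_of_ne_last (Fin.castSucc_lt_last t).ne]
    simp

/-! ### Rigidity of rainbow chains, and pigeonhole -/

namespace MvPolynomial

/-- Closed chains of pairs `(x, y)` with rainbow colours `i` are constant, provided that the sums
of squares of the values of `y` at all points of a large grid are constant along the chain. -/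
theorem eq_of_rainbow_chain {r L d K M k : ℕ} (hL : 0 < L)
    (x : Fin k → Fin d → (Fin r → Fin (L + 1)) → Fin K)
    (y : Fin k → Fin d → (Fin r → Fin L) → Fin M) (R : (Fin r → Fin (r * L)) → ℤ)
    (hy : ∀ t τ, ∑ b, eval (fun j => ((τ j : ℕ) : ℤ)) (ofBox (y t b)) ^ 2 = R τ)
    (i : Fin k → Fin r) (hi : Function.Injective i)
    (h : ∀ t b, ofBox (x t b) + X (i (finRotate k t)) * ofBox (y t b) =
      ofBox (x (finRotate k t) b) + X (i (finRotate k t)) * ofBox (y (finRotate k t) b))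
    (s t : Fin k) : x s = x t ∧ y s = y t := by
  have hkr : k ≤ r := by simpa using Fintype.card_le_of_injective i hi
  -- Position of a colour in the chain; the value 0 at unused colours is harmless.
  let q : Fin r → ℕ := Function.extend i (fun t => (t : ℕ)) fun _ => 0
  have hqi : ∀ t, q (i t) = t := fun t => hi.extend_apply _ _ t
  have hqr : ∀ j, q j < r := fun j => by
    by_cases hj : ∃ t, i t = j
    · obtain ⟨t, rfl⟩ := hj
      rw [hqi]
      omega
    · simp only [q, Function.extend_apply' _ _ _ hj]
      exact j.pos
  -- Successive blocks of length `L` order the coordinates along the chain and stay inside `{0, …, r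
  -- * L - 1}`, where the norms are controlled.
  let S : Fin r → Finset ℤ := fun j => Finset.Ico ((q j * L : ℕ) : ℤ) ((q j * L : ℕ) + L)
  have hsum : ∀ b, ∑ t, X (i (finRotate k t)) *
      (ofBox (y (finRotate k t) b) - ofBox (y t b)) = 0 := fun b => by
    have h1 : ∀ t, X (i (finRotate k t)) * (ofBox (y (finRotate k t) b) - ofBox (y t b)) =
        ofBox (x t b) - ofBox (x (finRotate k t) b) := fun t => by
      linear_combination -h t b
    simp_rw [h1]
    rw [Finset.sum_sub_distrib, Equiv.sum_comp (finRotate k) fun t => ofBox (x t b), sub_self]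
  have hyy : ∀ s t, y s = y t := fun s t => by
    ext b : 1
    refine ofBox_eq_of_eval_eq hL _ _ S (fun j => by simp [S]) fun z hz => ?_
    have hz' : ∀ j, ((q j * L : ℕ) : ℤ) ≤ z j ∧ z j < (q j * L : ℕ) + L :=
      fun j => Finset.mem_Ico.1 (hz j)
    have hmul : ∀ {p p' : ℕ}, p < p' → p * L + L ≤ p' * L := fun {p p'} hp => by
      calc _ = (p + 1) * L := by ring
        _ ≤ _ := Nat.mul_le_mul_right L hp
    have hzr : ∀ j, (z j).toNat < r * L := fun j => by
      have := hz' j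
      have := hmul (hqr j)
      omega
    have hzz : (fun j => (((⟨(z j).toNat, hzr j⟩ : Fin (r * L)) : ℕ) : ℤ)) = z := by
      ext j
      exact Int.toNat_of_nonneg (le_trans (by positivity) (hz' j).1)
    have hu := fun t => hy t fun j => ⟨(z j).toNat, hzr j⟩
    rw [hzz] at hu
    refine congrFun (eq_of_sum_mul_sub_finRotate_eq_zero (fun t => z (i t)) (fun t t' htt => ?_)
      (fun t b => eval z (ofBox (y t b))) _ hu (fun b => ?_) s t) b
    · have h1 := hz' (i t)
      have h2 := hz' (i t')
      rw [hqi] at h1 h2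
      have := hmul (Fin.lt_def.1 htt)
      dsimp only
      omega
    · have := congrArg (eval z) (hsum b)
      simpa only [map_sum, map_mul, map_sub, eval_X, map_zero] using this
  refine ⟨eq_of_forall_eq_finRotate x (fun t => ?_) s t, hyy s t⟩
  ext b : 1
  have := h t b
  rw [hyy (finRotate k t) t] at this
  exact ofBox_injective (add_right_cancel this)

/-- A large set of tuples `y` along which all the sums of squares of values are constant. -/
theorem exists_sum_sq_eval_const {r L : ℕ} (d : ℕ) : ∃ C : ℕ, 0 < C ∧
    ∀ M, 0 < M → ∃ (Y : Finset (Fin d → (Fin r → Fin L) → Fin M))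
      (R : (Fin r → Fin (r * L)) → ℤ),
      (∀ y ∈ Y, ∀ τ, ∑ b, eval (fun j => ((τ j : ℕ) : ℤ)) (ofBox (y b)) ^ 2 = R τ) ∧
      M ^ (d * L ^ r) ≤ Y.card * (C * M ^ 2) ^ (r * L) ^ r := by
  classical
  obtain ⟨W, hW⟩ := abs_eval_ofBox_le r L (r * L)
  refine ⟨d * W ^ 2 + 1, by omega, fun M hM => ?_⟩
  set V := (d * W ^ 2 + 1) * M ^ 2 with hV
  let key : (Fin d → (Fin r → Fin L) → Fin M) → (Fin r → Fin (r * L)) → ℤ := fun y τ =>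
    ∑ b, eval (fun j => ((τ j : ℕ) : ℤ)) (ofBox (y b)) ^ 2
  let T : Finset ((Fin r → Fin (r * L)) → ℤ) := Fintype.piFinset fun _ => Finset.Ico 0 (V : ℤ)
  have hT : T.card = V ^ (r * L) ^ r := by simp [T]
  have hmaps : ∀ y ∈ (Finset.univ : Finset (Fin d → (Fin r → Fin L) → Fin M)), key y ∈ T := by
    intro y _
    rw [Fintype.mem_piFinset]
    intro τ
    rw [Finset.mem_Ico]
    refine ⟨Finset.sum_nonneg fun b _ => sq_nonneg _, ?_⟩
    calc key y τ ≤ ∑ _b : Fin d, ((M * W : ℕ) : ℤ) ^ 2 :=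
          Finset.sum_le_sum fun b _ => sq_le_sq' (neg_le_of_abs_le (hW M (y b) τ))
            (le_of_abs_le (hW M (y b) τ))
      _ = ((d * W ^ 2 * M ^ 2 : ℕ) : ℤ) := by simp; ring
      _ < V := by
          rw [hV, add_mul, one_mul]
          exact_mod_cast Nat.lt_add_of_pos_right (by positivity)
  -- Pigeonhole: if every fibre of `key` were small, their sizes could not add up to the number of
  -- tuples.
  by_contra! hcon
  have hlt : ∀ R ∈ T, (Finset.univ.filter fun y => key y = R).card * V ^ (r * L) ^ r
      < M ^ (d * L ^ r) := fun R _ =>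
    hcon _ R fun y hy τ => congrFun (Finset.mem_filter.1 hy).2 τ
  have hTpos : 0 < T.card := by rw [hT]; positivity
  have hcard := Finset.card_eq_sum_card_fiberwise hmaps
  have h1 : (∑ R ∈ T, (Finset.univ.filter fun y => key y = R).card) * V ^ (r * L) ^ r
      < T.card * M ^ (d * L ^ r) := by
    rw [Finset.sum_mul, ← smul_eq_mul T.card, ← Finset.sum_const]
    exact Finset.sum_lt_sum_of_nonempty (Finset.card_pos.1 hTpos) hlt
  rw [← hcard, ← hT, mul_comm] at h1
  refine absurd h1 (not_lt.2 (Nat.mul_le_mul_left _ (le_of_eq ?_)))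
  simp [← pow_mul, mul_comm]

end MvPolynomial

/-! ### The construction and its edge count -/

namespace Hypergraph

open MvPolynomial in
theorem exists_rainbowCycle_free {r L : ℕ} (hr : 2 ≤ r) (hL : 0 < L) (d : ℕ) :
    ∃ C : ℕ, 0 < C ∧ ∀ M n, 0 < M → r * (2 * M) ^ (d * (L + 1) ^ r) ≤ n →
      ∃ (H : Hypergraph (Fin n)) (c : Fin n → Fin r), H.vertexSet = Set.univ ∧
        H.IsRUniform r ∧ H.IsPartiteColoring c ∧ H.IsLinearHypergraph ∧
        M ^ (d * (L + 1) ^ r + d * L ^ r) ≤ H.edgeSet.ncard * (C * M ^ 2) ^ (r * L) ^ r ∧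
        ∀ k, ¬ H.HasRainbowCycle c k := by
  obtain ⟨C, hC, hY⟩ := exists_sum_sq_eval_const (r := r) (L := L) d
  refine ⟨C, hC, fun M n hM hn => ?_⟩
  obtain ⟨Y, R, hR, hcard⟩ := hY M hM
  choose z hz using exists_ofBox_eq_add_X_mul (r := r) (L := L) hM
  let V := Fin r × (Fin d → (Fin r → Fin (L + 1)) → Fin (2 * M))
  obtain ⟨f⟩ : Nonempty (V ↪ Fin n) := Function.Embedding.nonempty_of_card_le (by
    refine le_of_eq_of_le ?_ (hn.trans_eq (Fintype.card_fin n).symm)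
    simp [V, ← pow_mul, mul_comm])
  -- Vertices of `Fin n` outside the image of `f` are isolated.
  let E := (Fin d → (Fin r → Fin (L + 1)) → Fin M) × Y
  let p : E → Fin r → Fin n := fun e i => f (i, fun b => z (e.1 b) (e.2.1 b) i)
  let c : Fin n → Fin r := Function.extend f Prod.fst fun _ => ⟨0, by omega⟩
  obtain ⟨H, h1, h2, h3, h4, h5, h6⟩ := exists_of_incidence hr p c
    (fun e i => f.injective.extend_apply _ _ _) (fun k _ i e hi hp s t => by
      have := eq_of_rainbow_chain hL (fun t => (e t).1) (fun t => (e t).2.1) R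
        (fun t => hR _ (e t).2.2) i hi (fun t b => by
          rw [← hz, ← hz]
          exact congrArg ofBox (congrFun (Prod.ext_iff.1 (f.injective (hp t))).2 b)) s t
      exact Prod.ext this.1 (Subtype.ext this.2))
  refine ⟨H, c, h1, h2, h3, h4, ?_, h6⟩
  have hE : Nat.card E = M ^ (d * (L + 1) ^ r) * Y.card := by
    simp [E, ← pow_mul, mul_comm]
  rw [h5, hE, pow_add, mul_assoc]
  exact Nat.mul_le_mul_left _ hcard

end Hypergraph

theorem exists_pow_div_succ_pow_gt (r : ℕ) {η : ℝ} (hη : 0 < η) :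
    ∃ L : ℕ, 0 < L ∧ (1 - η) * ((L : ℝ) + 1) ^ r < (L : ℝ) ^ r := by
  have h := (tendsto_natCast_div_add_atTop (1 : ℝ)).pow r
  rw [one_pow] at h
  obtain ⟨L, hL, hL0⟩ := ((h.eventually_const_lt (show 1 - η < 1 by linarith)).and
    (eventually_gt_atTop 0)).exists
  refine ⟨L, hL0, ?_⟩
  rwa [div_pow, lt_div_iff₀ (by positivity)] at hL

/-- Take the largest admissible `M`; it is at most `n` since `M ≤ r * (2 * M) ^ e`. -/
theorem exists_mul_two_mul_pow_le {r e M₀ n : ℕ} (hr : 0 < r) (he : 0 < e)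
    (hn : r * (2 * M₀) ^ e ≤ n) :
    ∃ M, M₀ ≤ M ∧ r * (2 * M) ^ e ≤ n ∧ n < r * (2 * (M + 1)) ^ e := by
  have hle : ∀ M, M ≤ r * (2 * M) ^ e := fun M =>
    calc M ≤ 2 * M := by omega
      _ ≤ (2 * M) ^ e := Nat.le_self_pow he.ne' _
      _ ≤ _ := Nat.le_mul_of_pos_left _ hr
  refine ⟨Nat.findGreatest (fun M => r * (2 * M) ^ e ≤ n) n,
    Nat.le_findGreatest ((hle _).trans hn) hn,
    Nat.findGreatest_spec (P := fun M => r * (2 * M) ^ e ≤ n) ((hle _).trans hn) hn, ?_⟩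
  by_cases h : Nat.findGreatest (fun M => r * (2 * M) ^ e ≤ n) n + 1 ≤ n
  · exact not_le.1 (Nat.findGreatest_is_greatest (P := fun M => r * (2 * M) ^ e ≤ n)
      (Nat.lt_succ_self _) h)
  · exact (not_le.1 h).trans_le (hle _)

namespace Hypergraph

theorem eventually_exists_rainbowCycle_free {r : ℕ} (hr : 2 ≤ r) {δ : ℝ} (hδ : 0 < δ)
    (hδ2 : δ ≤ 2) :
    ∀ᶠ n : ℕ in atTop, ∃ (H : Hypergraph (Fin n)) (c : Fin n → Fin r), H.vertexSet = Set.univ ∧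
        H.IsRUniform r ∧ H.IsPartiteColoring c ∧ H.IsLinearHypergraph ∧
        (n : ℝ) ^ (2 - δ) < (H.edgeSet.ncard : ℝ) ∧ ∀ k, ¬ H.HasRainbowCycle c k := by
  obtain ⟨L, hL, hLη⟩ := exists_pow_div_succ_pow_gt r (half_pos hδ)
  have hB : (0 : ℝ) < ((L : ℝ) + 1) ^ r := by positivity
  set q := (r * L) ^ r with hq
  -- The gain `d * (L + 1) ^ r * (δ / 2)` must exceed the pigeonhole loss `2 * q`.
  obtain ⟨d, hd⟩ := exists_nat_gt (2 * (q : ℝ) / (((L : ℝ) + 1) ^ r * (δ / 2)))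
  rw [div_lt_iff₀ (by positivity)] at hd
  have hd0 : 0 < d := by
    rcases Nat.eq_zero_or_pos d with rfl | h
    · exfalso
      rw [Nat.cast_zero, zero_mul] at hd
      exact absurd hd (not_lt.2 (by positivity))
    · exact h
  obtain ⟨C, hC, hH⟩ := exists_rainbowCycle_free hr hL d
  set e := d * (L + 1) ^ r with he
  set e' := d * L ^ r with he'
  have he0 : 0 < e := by positivity
  -- Surplus in the exponent of `M`; `M ^ s` eventually absorbs all constants, collected in `K`.
  let s : ℝ := e + e' - 2 * q - e * (2 - δ)
  have hs : 0 < s := by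
    have hd0' : (0 : ℝ) < d := by exact_mod_cast hd0
    have := mul_lt_mul_of_pos_left hLη hd0'
    simp only [s, he, he']
    push_cast
    linarith
  let K : ℝ := (C : ℝ) ^ q * ((r : ℝ) * 4 ^ e) ^ 2
  obtain ⟨M₀, hM₀⟩ := eventually_atTop.1 (((tendsto_rpow_atTop hs).comp
    tendsto_natCast_atTop_atTop).eventually_gt_atTop K)
  filter_upwards [eventually_ge_atTop (r * (2 * (M₀ + 1)) ^ e)] with n hn
  obtain ⟨M, hM, hMn, hnM⟩ := exists_mul_two_mul_pow_le (by omega) he0 hn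
  have hMpos : 0 < M := by omega
  have hM0 : (0 : ℝ) < M := by exact_mod_cast hMpos
  obtain ⟨H, c, h1, h2, h3, h4, h5, h6⟩ := hH M n hMpos hMn
  refine ⟨H, c, h1, h2, h3, h4, ?_, h6⟩
  have hKM : K < (M : ℝ) ^ s := hM₀ M (by omega)
  -- Maximality of `M`, with `2 * (M + 1) ≤ 4 * M`.
  have hn4 : (n : ℝ) ≤ (r * 4 ^ e) * (M : ℝ) ^ e := by
    have : n ≤ r * 4 ^ e * M ^ e := by
      rw [mul_assoc, ← mul_pow]
      exact hnM.le.trans (Nat.mul_le_mul_left _ (Nat.pow_le_pow_left (by omega) _))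
    exact_mod_cast this
  have hr4 : (1 : ℝ) ≤ r * 4 ^ e := by
    have : 1 ≤ r * 4 ^ e := Nat.succ_le_of_lt (by positivity)
    exact_mod_cast this
  have hn2 : (n : ℝ) ^ (2 - δ) ≤ (r * 4 ^ e) ^ 2 * (M : ℝ) ^ ((e : ℝ) * (2 - δ)) :=
    calc (n : ℝ) ^ (2 - δ) ≤ ((r * 4 ^ e) * (M : ℝ) ^ e) ^ (2 - δ) :=
          Real.rpow_le_rpow (by positivity) hn4 (by linarith)
      _ = ((r : ℝ) * 4 ^ e) ^ (2 - δ) * (M : ℝ) ^ ((e : ℝ) * (2 - δ)) := by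
          rw [Real.mul_rpow (by positivity) (by positivity), Real.rpow_mul hM0.le,
            Real.rpow_natCast]
      _ ≤ _ := by
          refine mul_le_mul_of_nonneg_right ?_ (by positivity)
          rw [← Real.rpow_natCast _ 2]
          exact Real.rpow_le_rpow_of_exponent_le hr4 (by push_cast; linarith)
  have h5' : (M : ℝ) ^ (e + e') ≤ H.edgeSet.ncard * ((C : ℝ) ^ q * (M : ℝ) ^ (2 * q)) := by
    rw [pow_mul, ← mul_pow]
    exact_mod_cast h5
  have hpos : (0 : ℝ) < (C : ℝ) ^ q * (M : ℝ) ^ (2 * q) := by positivity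
  refine lt_of_mul_lt_mul_right (lt_of_lt_of_le ?_ h5') hpos.le
  calc (n : ℝ) ^ (2 - δ) * ((C : ℝ) ^ q * (M : ℝ) ^ (2 * q))
      ≤ (r * 4 ^ e) ^ 2 * (M : ℝ) ^ ((e : ℝ) * (2 - δ)) * ((C : ℝ) ^ q * (M : ℝ) ^ (2 * q)) :=
        mul_le_mul_of_nonneg_right hn2 hpos.le
    _ = K * ((M : ℝ) ^ ((e : ℝ) * (2 - δ)) * (M : ℝ) ^ (2 * q)) := by ring
    _ < (M : ℝ) ^ s * ((M : ℝ) ^ ((e : ℝ) * (2 - δ)) * (M : ℝ) ^ (2 * q)) :=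
        mul_lt_mul_of_pos_right hKM (by positivity)
    _ = (M : ℝ) ^ (e + e') := by
        rw [← Real.rpow_natCast _ (2 * q), ← Real.rpow_natCast _ (e + e'), ← Real.rpow_add hM0,
          ← Real.rpow_add hM0]
        congr 1
        simp only [s]
        push_cast
        ring

end Hypergraph

/-! ### Letting the exponent loss tend to zero -/

/-- Diagonalisation: properties `P j`, each of which holds eventually, hold along some sequence of
indices tending to infinity. -/
theorem exists_tendsto_atTop_eventually {P : ℕ → ℕ → Prop} (h : ∀ j, ∀ᶠ n in atTop, P j n) :
    ∃ J : ℕ → ℕ, Tendsto J atTop atTop ∧ ∀ᶠ n in atTop, P (J n) n := by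
  classical
  choose N hN using fun j => eventually_atTop.1 (h j)
  -- Use the largest `j ≤ n` whose threshold `N j` has been passed.
  refine ⟨fun n => Nat.findGreatest (fun j => N j ≤ n) n, ?_, ?_⟩
  · refine tendsto_atTop.2 fun j => ?_
    filter_upwards [eventually_ge_atTop (N j), eventually_ge_atTop j] with n h1 h2
    exact Nat.le_findGreatest h2 h1
  · filter_upwards [eventually_ge_atTop (N 0)] with n hn
    exact hN _ _ (Nat.findGreatest_spec (P := fun j => N j ≤ n) (Nat.zero_le n) hn)

theorem theorem1p5 (r : ℕ) (hr : 3 ≤ r) :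
    ∃ ε : ℕ → ℝ, Tendsto ε atTop (𝓝 0) ∧
      ∀ᶠ n : ℕ in atTop, ∃ (H : Hypergraph (Fin n)) (c : Fin n → Fin r),
        H.vertexSet = Set.univ ∧
        H.IsRUniform r ∧
        H.IsPartiteColoring c ∧
        H.IsLinearHypergraph ∧
        (n : ℝ) ^ (2 - ε n) < (H.edgeSet.ncard : ℝ) ∧
        ¬ H.HasRainbowCycle c 3 ∧
        ¬ H.HasRainbowCycle c 4 := by
  obtain ⟨J, hJ, hev⟩ := exists_tendsto_atTop_eventually fun j : ℕ =>
    Hypergraph.eventually_exists_rainbowCycle_free (r := r) (by omega)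
      (δ := 1 / ((j : ℝ) + 1)) Nat.one_div_pos_of_nat (by
        rw [div_le_iff₀ (by positivity)]
        have : (0 : ℝ) ≤ j := j.cast_nonneg
        linarith)
  refine ⟨fun n => 1 / ((J n : ℝ) + 1), tendsto_one_div_add_atTop_nhds_zero_nat.comp hJ, ?_⟩
  filter_upwards [hev] with n ⟨H, c, h1, h2, h3, h4, h5, h6⟩
  exact ⟨H, c, h1, h2, h3, h4, h5, h6 3, h6 4⟩
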